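/- Fix a dimension $d$ and a norm $\|\cdot\|$ on $\mathbb R^d$. Let $\beta$ be the Besicovitch constant of $(\mathbb R^d,\|\cdot\|)$, i.e. the least integer such that for every $P\subseteq\mathbb R^d$ and every $\delta>0$ there are $\beta$ countable families of pairwise disjoint closed balls of radius $\delta$ with centres in $P$, the union of all of which covers $P$. Fix $p\in(0,1)$ and $\alpha\in(0,1/\beta^2]$. Then there are constants $C_1>0$ and $C_2\in(0,1)$, depending only on $d$, $\|\cdot\|$, $p$ and $\alpha$, such that the following holds. Let $\nu$ be a probability distribution on $\mathbb R^d$ with an essentially bounded density, let $X_1,X_2,\dots$ be independent with law $\nu$, let $r=r(n)>0$ with $r(n)\to0$ and $nr^d\le n^{-\alpha}$ for all sufficiently large $n$, and let $q=q(n)\in[0,1]$. Let $G_n$ be the graph on the vertices $X_1,\dots,X_n$ in which distinct $X_i,X_j$ are adjacent if and only if $\|X_i-X_j\|\le r(n)$, and let $G_n^{p,q}$ be obtained from $G_n$ by deleting each edge of $G_n$ with probability $p$ and inserting each non-edge of $G_n$ with probability $q(n)$, all independently. Write $\omega$ for the clique number. a) If $q\le (1/n)^{C_1}$ for all sufficiently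 large $n$, then a.s. $\omega(G_n^{p,q})\sim 1$. b) If $(1/n)^{C_1}<q\le C_2$ for all sufficiently large $n$, then a.s. $\omega(G_n^{p,q})\sim\log_{1/q}n$. Here "a.s. $\xi_n\sim k_n$" means that there are constants $c,C>0$ such that $\mathbb P[\xi_n\le Ck_n]\to1$ and $\mathbb P[\xi_n\ge ck_n]\to1$ as $n\to\infty$. -/

import Mathlib

open MeasureTheory Filter Topology ProbabilityTheory
open scoped ENNReal unitInterval

namespace NoisyRGG

/-! ### The Besicovitch constant of `ℝ^d` with an arbitrary norm -/

/-- `m` is admissible in the Besicovitch covering lemma for `ℝ^d` with the norm `N`: for every set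
`P` of points and every `δ > 0` there are `m` packings by closed `N`-balls of radius `δ` centred in
`P`, whose union covers `P`. A packing by balls of the fixed radius `δ` is given by its countable
set `A i` of centres, the balls around distinct centres being disjoint. -/
def IsBesicovitchBound {d : ℕ} (N : Seminorm ℝ (Fin d → ℝ)) (m : ℕ) : Prop :=
  ∀ (P : Set (Fin d → ℝ)) (δ : ℝ), 0 < δ → ∃ A : Fin m → Set (Fin d → ℝ),
    (∀ i, A i ⊆ P ∧ (A i).Countable ∧ (A i).PairwiseDisjoint fun c => {y | N (y - c) ≤ δ}) ∧
      P ⊆ ⋃ i, ⋃ c ∈ A i, {y | N (y - c) ≤ δ}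

/-- The Besicovitch constant of `(ℝ^d, N)`: the least admissible number of packings. -/
noncomputable def besicovitchConst {d : ℕ} (N : Seminorm ℝ (Fin d → ℝ)) : ℕ :=
  sInf {m | IsBesicovitchBound N m}

theorem exists_packings (E : Type*) [NormedAddCommGroup E] [NormedSpace ℝ E]
    [FiniteDimensional ℝ E] :
    ∃ m : ℕ, ∀ (P : Set E) (δ : ℝ), 0 < δ → ∃ A : Fin m → Set E,
      (∀ i, A i ⊆ P ∧ (A i).Countable ∧ (A i).PairwiseDisjoint fun c => {y | ‖y - c‖ ≤ δ}) ∧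
        P ⊆ ⋃ i, ⋃ c ∈ A i, {y | ‖y - c‖ ≤ δ} := by
  obtain ⟨m, τ, hτ, hm⟩ := HasBesicovitchCovering.no_satelliteConfig (α := E)
  refine ⟨m, fun P δ hδ => ?_⟩
  have hball : ∀ c : E, {y | ‖y - c‖ ≤ δ} = Metric.closedBall c δ := by
    intro c; ext y; exact mem_closedBall_iff_norm.symm
  simp only [hball]
  obtain ⟨s, hs, hcov⟩ := Besicovitch.exist_disjoint_covering_families hτ hm
    (⟨fun x : P => (x : E), fun _ => δ, fun _ => hδ, δ, fun _ => le_rfl⟩ :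
      Besicovitch.BallPackage P E)
  have hdisj : ∀ i, (Subtype.val '' s i : Set E).PairwiseDisjoint
      fun c => Metric.closedBall c δ := by
    rintro i _ ⟨x, hx, rfl⟩ _ ⟨y, hy, rfl⟩ hxy
    exact hs i hx hy (fun h => hxy (congrArg _ h))
  refine ⟨fun i => Subtype.val '' s i, fun i => ⟨?_, ?_, hdisj i⟩, ?_⟩
  · rintro _ ⟨x, -, rfl⟩
    exact x.2
  · have := FiniteDimensional.proper ℝ E
    refine (hdisj i).countable_of_nonempty_interior fun c _ => ?_
    exact ⟨c, Metric.ball_subset_interior_closedBall (Metric.mem_ball_self hδ)⟩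
  · intro x hx
    have h := hcov ⟨⟨x, hx⟩, rfl⟩
    simp only [Set.mem_iUnion] at h ⊢
    obtain ⟨i, j, hj, hxj⟩ := h
    exact ⟨i, j, ⟨j, hj, rfl⟩, Metric.ball_subset_closedBall hxj⟩

/-- The Besicovitch covering lemma: an admissible number of packings exists. -/
theorem exists_isBesicovitchBound {d : ℕ} (N : Seminorm ℝ (Fin d → ℝ))
    (hN : ∀ x, N x = 0 → x = 0) : ∃ m, IsBesicovitchBound N m := by
  let G : AddGroupNorm (Fin d → ℝ) :=
    { N.toAddGroupSeminorm with eq_zero_of_map_eq_zero' := hN }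
  let i₁ : NormedAddCommGroup (Fin d → ℝ) := G.toNormedAddCommGroup
  let i₂ : @NormedSpace ℝ (Fin d → ℝ) _ i₁.toSeminormedAddCommGroup :=
    @NormedSpace.mk ℝ (Fin d → ℝ) _ i₁.toSeminormedAddCommGroup _
      fun a x => (map_smul_eq_mul N a x).le
  have hfin : FiniteDimensional ℝ (Fin d → ℝ) := inferInstance
  exact @exists_packings (Fin d → ℝ) i₁ i₂ hfin

/-- The Besicovitch constant is itself admissible. -/
theorem isBesicovitchBound_besicovitchConst {d : ℕ} (N : Seminorm ℝ (Fin d → ℝ))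
    (hN : ∀ x, N x = 0 → x = 0) : IsBesicovitchBound N (besicovitchConst N) :=
  Nat.sInf_mem (exists_isBesicovitchBound N hN)

/-! ### Noisy random geometric graphs -/

/-- `ν` has a density with respect to Lebesgue measure whose essential supremum (the maximum
density of `ν`) is finite. -/
def HasBoundedDensity {d : ℕ} (ν : Measure (Fin d → ℝ)) : Prop :=
  ∃ f : (Fin d → ℝ) → ℝ≥0∞, Measurable f ∧ essSup f volume < ⊤ ∧ ν = volume.withDensity f

/-- The geometric graph on the points `x 0, …, x (n - 1)`: distinct vertices are adjacent when
their points are at `N`-distance at most `r`. -/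
def geometricGraph {d n : ℕ} (N : Seminorm ℝ (Fin d → ℝ)) (r : ℝ) (x : Fin n → Fin d → ℝ) :
    SimpleGraph (Fin n) where
  Adj i j := i ≠ j ∧ N (x i - x j) ≤ r
  symm := ⟨fun i j h => ⟨h.1.symm, by rw [map_sub_rev]; exact h.2⟩⟩
  loopless := ⟨fun _ h => h.1 rfl⟩

/-- The perturbation of `G` in which an edge `e` of `G` is deleted when `del e = true` and a
non-edge `e` of `G` is inserted when `ins e = true`. -/
def perturb {V : Type*} (G : SimpleGraph V) (del ins : Sym2 V → Bool) : SimpleGraph V where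
  Adj u v := u ≠ v ∧
    ((G.Adj u v ∧ del s(u, v) = false) ∨ (¬ G.Adj u v ∧ ins s(u, v) = true))
  symm := ⟨fun u v h => by rw [Sym2.eq_swap, G.adj_comm]; exact ⟨h.1.symm, h.2⟩⟩
  loopless := ⟨fun _ h => h.1 rfl⟩

/-- Sample space: `n` points of `ℝ^d`, a deletion mark and an insertion mark for every pair. -/
abbrev Sample (d n : ℕ) : Type :=
  (Fin n → Fin d → ℝ) × (Sym2 (Fin n) → Bool) × (Sym2 (Fin n) → Bool)

/-- The points are independent with law `ν`, the deletion marks are Bernoulli with parameter `p`,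
the insertion marks are Bernoulli with parameter `q`, and all of these are independent. -/
noncomputable def sampleMeasure {d : ℕ} (ν : Measure (Fin d → ℝ)) (p q : I) (n : ℕ) :
    Measure (Sample d n) :=
  (Measure.pi fun _ : Fin n => ν).prod
    ((Measure.pi fun _ : Sym2 (Fin n) => bernoulliMeasure true false p).prod
      (Measure.pi fun _ : Sym2 (Fin n) => bernoulliMeasure true false q))

/-- The noisy random geometric graph on `n` vertices with connection distance `r`; under
`sampleMeasure ν p q n` it is the `(p, q)`-perturbed one. -/
def noisyGraph {d : ℕ} (N : Seminorm ℝ (Fin d → ℝ)) (r : ℝ) (n : ℕ) (s : Sample d n) :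
    SimpleGraph (Fin n) :=
  perturb (geometricGraph N r s.1) s.2.1 s.2.2

/-! ### Orders of magnitude with probability tending to one -/

/-- `ξ n ∼ k n` almost surely, in the sense of probabilities tending to one (the `ξ n` may live on
different probability spaces): there is `C > 0` such that `ξ n ≤ C * k n` with probability tending
to `1`, and there is `c > 0` such that `c * k n ≤ ξ n` with probability tending to `1`. -/
def SameOrderWHP {Ω : ℕ → Type*} [∀ n, MeasurableSpace (Ω n)] (μ : ∀ n, Measure (Ω n))
    (ξ : ∀ n, Ω n → ℝ) (k : ℕ → ℝ) : Prop :=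
  (∃ C : ℝ, 0 < C ∧ Tendsto (fun n => μ n {s | ξ n s ≤ C * k n}) atTop (𝓝 1)) ∧
    (∃ c : ℝ, 0 < c ∧ Tendsto (fun n => μ n {s | c * k n ≤ ξ n s}) atTop (𝓝 1))

end NoisyRGG

namespace NoisyRGG

/-! Upper bounds: a ball of radius r has mass at most K r^d, so the expected number of pairs
(vertex, M of its neighbours) in the geometric graph is at most n (n K r^d)^M ≤ K^M n^(1 - αM). For
a fixed M > 1/α this tends to 0, so with high probability all degrees are below M
(`pi_exists_degree_le`). Then every clique of the noisy graph contains a 1/M fraction of its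
vertices independent in the geometric graph, and those can be joined only by insertions. Hence ω is
at most M times the clique number of the insertion marks, an Erdős–Rényi graph with edge probability
q, which a first moment controls (`cliqueNum_perturb_le`, `sampleMeasure_cliqueNum_gt_le`).

Lower bounds: in a) a single vertex suffices. In b), q ≤ 1 - p, so whatever the points are, each
pair is joined independently with probability at least q. For k about half of log_{1/q} n, a union
bound over k-sets gives each of them a common neighbour, and a clique grows greedily to k + 1
vertices (`sampleMeasure_no_extension_le`, `lt_cliqueNum_of_extension`). -/

/-! ### Comparison of norms and the mass of small balls. -/

theorem continuous_seminorm {d : ℕ} (N : Seminorm ℝ (Fin d → ℝ)) : Continuous N :=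
  (ConvexOn.locallyLipschitz N.convexOn).continuous

theorem exists_mul_norm_le {d : ℕ} (N : Seminorm ℝ (Fin d → ℝ)) (hN : ∀ x, N x = 0 → x = 0) :
    ∃ c : ℝ, 0 < c ∧ ∀ x, c * ‖x‖ ≤ N x := by
  rcases (Metric.sphere (0 : Fin d → ℝ) 1).eq_empty_or_nonempty with h | h
  · refine ⟨1, one_pos, fun x => ?_⟩
    have hx : x = 0 := by
      by_contra hx
      have : ‖x‖⁻¹ • x ∈ Metric.sphere (0 : Fin d → ℝ) 1 := by
        simp [norm_smul, hx]
      simp [h] at this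
    simp [hx]
  · obtain ⟨y, hy, hmin⟩ := (isCompact_sphere (0 : Fin d → ℝ) 1).exists_isMinOn h
      (continuous_seminorm N).continuousOn
    have hy0 : y ≠ 0 := by
      rintro rfl
      simp at hy
    refine ⟨N y, lt_of_le_of_ne (apply_nonneg N y) fun h0 => hy0 (hN y h0.symm), fun x => ?_⟩
    rcases eq_or_ne x 0 with rfl | hx
    · simp
    have hmem : ‖x‖⁻¹ • x ∈ Metric.sphere (0 : Fin d → ℝ) 1 := by
      simp [norm_smul, hx]
    have := hmin hmem
    simp only [Set.mem_ofPred_eq, map_smul_eq_mul, norm_inv, norm_norm] at this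
    rwa [← div_eq_inv_mul, le_div_iff₀ (norm_pos_iff.2 hx)] at this

/-- Balls of radius `r` have mass at most of order `r ^ d`. -/
theorem HasBoundedDensity.exists_ball_le {d : ℕ} {ν : Measure (Fin d → ℝ)}
    (hν : HasBoundedDensity ν) (N : Seminorm ℝ (Fin d → ℝ)) (hN : ∀ x, N x = 0 → x = 0) :
    ∃ K : ℝ, 0 < K ∧ ∀ (y : Fin d → ℝ) (r : ℝ), 0 < r →
      ν {z | N (y - z) ≤ r} ≤ ENNReal.ofReal (K * r ^ d) := by
  obtain ⟨f, -, hfs, rfl⟩ := hν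
  obtain ⟨c, hc, hcN⟩ := exists_mul_norm_le N hN
  set S := essSup f volume with hS
  -- The enclosing sup-norm ball is a cube of side 2r/c; the `+ 1` keeps the constant positive even
  -- if `S = 0`.
  refine ⟨(S.toReal + 1) * (2 / c) ^ d, by positivity, fun y r hr => ?_⟩
  have hsub : {z | N (y - z) ≤ r} ⊆ Metric.closedBall y (r / c) := by
    intro z hz
    rw [Metric.mem_closedBall, dist_comm, dist_eq_norm, le_div_iff₀ hc, mul_comm]
    exact (hcN _).trans hz
  calc (volume.withDensity f) {z | N (y - z) ≤ r}
      ≤ (volume.withDensity f) (Metric.closedBall y (r / c)) := measure_mono hsub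
    _ = ∫⁻ z in Metric.closedBall y (r / c), f z :=
        withDensity_apply _ Metric.isClosed_closedBall.measurableSet
    _ ≤ ∫⁻ _ in Metric.closedBall y (r / c), S :=
        lintegral_mono_ae (ae_restrict_of_ae (ENNReal.ae_le_essSup f))
    _ = S * ENNReal.ofReal ((2 * (r / c)) ^ d) := by
        rw [setLIntegral_const, Real.volume_pi_closedBall _ (by positivity), Fintype.card_fin]
    _ ≤ ENNReal.ofReal (S.toReal + 1) * ENNReal.ofReal ((2 * (r / c)) ^ d) := by
        gcongr
        rw [← ENNReal.ofReal_toReal hfs.ne]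
        exact ENNReal.ofReal_le_ofReal (by simp)
    _ = ENNReal.ofReal ((S.toReal + 1) * (2 / c) ^ d * r ^ d) := by
        rw [← ENNReal.ofReal_mul (by positivity), mul_assoc, ← mul_pow]
        congr 3
        ring

/-! ### Degrees in the geometric graph. -/

/-- A measurable set all of whose sections have measure at most `c` has measure at most `c`. -/
theorem prod_le_of_section_le {A B : Type*} [MeasurableSpace A] [MeasurableSpace B]
    (μ : Measure A) [IsProbabilityMeasure μ] (ρ : Measure B) [SFinite ρ] {s : Set (A × B)}
    (hs : MeasurableSet s) {c : ℝ≥0∞} (h : ∀ a, ρ {b | (a, b) ∈ s} ≤ c) : μ.prod ρ s ≤ c := by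
  rw [Measure.prod_apply hs]
  calc ∫⁻ a, ρ (Prod.mk a ⁻¹' s) ∂μ ≤ ∫⁻ _, c ∂μ := lintegral_mono h
    _ = c := by simp

/-- The probability that all the points in `T` are close to another given point. -/
theorem pi_near_le {d n : ℕ} {ν : Measure (Fin d → ℝ)} [IsProbabilityMeasure ν]
    (N : Seminorm ℝ (Fin d → ℝ)) {r : ℝ} {c : ℝ≥0∞} (hc : ∀ y, ν {z | N (y - z) ≤ r} ≤ c)
    (i : Fin n) (T : Finset (Fin n)) (hi : i ∉ T) :
    (Measure.pi fun _ : Fin n => ν) {x | ∀ j ∈ T, N (x i - x j) ≤ r} ≤ c ^ T.card := by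
  classical
  obtain _ | m := n
  · exact i.elim0
  obtain ⟨T', rfl⟩ : ∃ T' : Finset (Fin m), T'.map i.succAboveEmb = T := by
    refine ⟨Finset.univ.filter fun j => i.succAbove j ∈ T, ?_⟩
    ext j
    simp only [Finset.mem_map, Finset.mem_filter, Finset.mem_univ, true_and, Fin.succAboveEmb_apply]
    constructor
    · rintro ⟨k, hk, rfl⟩
      exact hk
    · intro hj
      obtain ⟨k, rfl⟩ := Fin.exists_succAbove_eq (show j ≠ i from fun h => hi (h ▸ hj))
      exact ⟨k, hj, rfl⟩
  -- Split off the coordinate `i`: once `x i` is fixed, the conditions on the other points are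
  -- independent.
  have hmp := measurePreserving_piFinSuccAbove (fun _ : Fin (m + 1) => ν) i
  set s : Set ((Fin d → ℝ) × (Fin m → Fin d → ℝ)) := {a | ∀ j ∈ T', N (a.1 - a.2 j) ≤ r} with hs
  have hsm : MeasurableSet s := by
    have : s = ⋂ j ∈ T', {a | N (a.1 - a.2 j) ≤ r} := by
      ext a; simp [hs]
    rw [this]
    refine Finset.measurableSet_biInter _ fun j _ => measurableSet_le ?_ measurable_const
    exact (continuous_seminorm N).measurable.comp
      (measurable_fst.sub ((measurable_pi_apply j).comp measurable_snd))
  have hpre : {x : Fin (m + 1) → Fin d → ℝ | ∀ j ∈ T'.map i.succAboveEmb, N (x i - x j) ≤ r} =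
      MeasurableEquiv.piFinSuccAbove (fun _ => Fin d → ℝ) i ⁻¹' s := by
    ext x
    simp [hs, Fin.insertNthEquiv, Fin.removeNth]
  rw [hpre, hmp.measure_preimage_equiv, Finset.card_map]
  refine prod_le_of_section_le _ _ hsm fun y => ?_
  have : {b | (y, b) ∈ s} =
      Set.univ.pi fun j => if j ∈ T' then {z | N (y - z) ≤ r} else Set.univ := by
    ext b
    simp only [hs, Set.mem_ofPred_eq, Set.mem_univ_pi]
    refine forall_congr' fun j => ?_
    by_cases hj : j ∈ T' <;> simp [hj]
  rw [this, Measure.pi_pi]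
  calc ∏ j, ν (if j ∈ T' then {z | N (y - z) ≤ r} else Set.univ)
      ≤ ∏ j, (if j ∈ T' then c else 1) := by
        refine Finset.prod_le_prod' fun j _ => ?_
        split_ifs
        · exact hc y
        · simp
    _ = c ^ T'.card := by simp [Finset.prod_ite_mem]

/-- The probability that some vertex of the geometric graph has at least `M` neighbours. -/
theorem pi_exists_degree_le {d n M : ℕ} {ν : Measure (Fin d → ℝ)} [IsProbabilityMeasure ν]
    (N : Seminorm ℝ (Fin d → ℝ)) {r : ℝ} {c : ℝ≥0∞} (hc : ∀ y, ν {z | N (y - z) ≤ r} ≤ c) :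
    (Measure.pi fun _ : Fin n => ν) {x | ∃ i, ∃ T : Finset (Fin n), T.card = M ∧
      ∀ j ∈ T, (geometricGraph N r x).Adj i j} ≤ n * (n * c) ^ M := by
  classical
  have hsub : {x | ∃ i, ∃ T : Finset (Fin n), T.card = M ∧
      ∀ j ∈ T, (geometricGraph N r x).Adj i j} ⊆
      ⋃ i : Fin n, ⋃ T ∈ (Finset.univ.powersetCard M).filter fun T : Finset (Fin n) => i ∉ T,
        {x : Fin n → Fin d → ℝ | ∀ j ∈ T, N (x i - x j) ≤ r} := by
    rintro x ⟨i, T, hT, h⟩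
    simp only [Set.mem_iUnion]
    refine ⟨i, T, ?_, fun j hj => (h j hj).2⟩
    simp only [Finset.mem_filter, Finset.mem_powersetCard, Finset.subset_univ, true_and]
    exact ⟨hT, fun hi => (h i hi).1 rfl⟩
  calc _ ≤ ∑ i : Fin n, ∑ T ∈ (Finset.univ.powersetCard M).filter
        fun T : Finset (Fin n) => i ∉ T, (Measure.pi fun _ : Fin n => ν)
          {x : Fin n → Fin d → ℝ | ∀ j ∈ T, N (x i - x j) ≤ r} := by
        refine (measure_mono hsub).trans ((measure_iUnion_fintype_le _ _).trans ?_)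
        exact Finset.sum_le_sum fun i _ => measure_biUnion_finset_le _ _
    _ ≤ ∑ i : Fin n, ∑ T ∈ Finset.univ.powersetCard M, c ^ M := by
        refine Finset.sum_le_sum fun i _ => ?_
        refine (Finset.sum_le_sum fun T hT => ?_).trans
          (Finset.sum_le_sum_of_subset (Finset.filter_subset _ _))
        simp only [Finset.mem_filter, Finset.mem_powersetCard, Finset.subset_univ, true_and] at hT
        exact hT.1 ▸ pi_near_le N hc i T hT.2
    _ = n * (n.choose M * c ^ M) := by simp
    _ ≤ n * (n * c) ^ M := by
        rw [mul_pow]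
        gcongr
        exact_mod_cast Nat.choose_le_pow n M

/-! ### Deterministic bounds on the clique number. -/

/-- If no vertex has `M` neighbours, every vertex set contains an independent subset of a
`1 / M` fraction of its size. -/
theorem exists_independent_subset {V : Type*} [Fintype V] (G : SimpleGraph V) {M : ℕ}
    (hM : ∀ i, ∀ T : Finset V, T.card = M → ¬ ∀ j ∈ T, G.Adj i j) (K : Finset V) :
    ∃ A ⊆ K, (∀ u ∈ A, ∀ v ∈ A, ¬ G.Adj u v) ∧ K.card ≤ M * A.card := by
  classical
  obtain ⟨A, hA, hmax⟩ := Finset.exists_max_image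
    (K.powerset.filter fun A => ∀ u ∈ A, ∀ v ∈ A, ¬ G.Adj u v) Finset.card ⟨∅, by simp⟩
  simp only [Finset.mem_filter, Finset.mem_powerset] at hA hmax
  refine ⟨A, hA.1, hA.2, ?_⟩
  -- By maximality of `A`, the closed neighbourhoods of its vertices cover `K`. Each has at most `M`
  -- elements, since open ones have fewer than `M`.
  have hcov : K ⊆ A.biUnion fun i => insert i (Finset.univ.filter fun j => G.Adj i j) := by
    intro v hv
    simp only [Finset.mem_biUnion, Finset.mem_insert, Finset.mem_filter, Finset.mem_univ, true_and]
    by_contra! hcon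
    have hvI : v ∉ A := fun h => (hcon v h).1 rfl
    have := hmax (insert v A) ⟨Finset.insert_subset hv hA.1, by
      intro a ha b hb
      rw [Finset.mem_insert] at ha hb
      rcases ha with rfl | ha <;> rcases hb with rfl | hb
      · exact G.loopless.irrefl _
      · exact fun h => (hcon b hb).2 h.symm
      · exact (hcon a ha).2
      · exact hA.2 a ha b hb⟩
    rw [Finset.card_insert_of_notMem hvI] at this
    omega
  calc K.card ≤ _ := Finset.card_le_card hcov
    _ ≤ A.card * M := by
      refine Finset.card_biUnion_le_card_mul _ _ _ fun i _ => ?_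
      refine (Finset.card_insert_le _ _).trans ?_
      by_contra! hlt
      obtain ⟨T, hT, hTc⟩ := Finset.exists_subset_card_eq (Nat.lt_succ_iff.1 hlt)
      exact hM i T hTc fun j hj => (Finset.mem_filter.1 (hT hj)).2
    _ = M * A.card := mul_comm _ _

/-- Vertices of a perturbed clique that are independent in `G` form a clique of insertion marks, so
there are at most `m` of them; they make up at least a 1/M fraction of the clique. -/
theorem cliqueNum_perturb_le {V : Type*} [Fintype V] (G : SimpleGraph V) (del ins : Sym2 V → Bool)
    {M m : ℕ} (hM : ∀ i, ∀ T : Finset V, T.card = M → ¬ ∀ j ∈ T, G.Adj i j)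
    (hm : ∀ A : Finset V, A.card = m + 1 → ¬ ∀ u ∈ A, ∀ v ∈ A, u ≠ v → ins s(u, v) = true) :
    (perturb G del ins).cliqueNum ≤ M * m := by
  obtain ⟨K, hK⟩ := (perturb G del ins).exists_isNClique_cliqueNum
  obtain ⟨A, hAK, hA, hcard⟩ := exists_independent_subset G hM K
  rw [← hK.card_eq]
  refine hcard.trans (Nat.mul_le_mul_left _ ?_)
  by_contra! hlt
  obtain ⟨J, hJ, hJc⟩ := Finset.exists_subset_card_eq (Nat.succ_le_of_lt hlt)
  refine hm J hJc fun u hu v hv huv => ?_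
  have hadj := hK.isClique (hAK (hJ hu)) (hAK (hJ hv)) huv
  exact (hadj.2.resolve_left fun h => hA u (hJ hu) v (hJ hv) h.1).2

/-- If every `k` vertices have a common neighbour, there is a clique of size `k + 1`. -/
theorem lt_cliqueNum_of_extension {V : Type*} [Fintype V] (G : SimpleGraph V) {k : ℕ}
    (hk : k ≤ Fintype.card V)
    (h : ∀ S : Finset V, S.card = k → ∃ v ∉ S, ∀ u ∈ S, G.Adj u v) : k < G.cliqueNum := by
  classical
  have key : ∀ j ≤ k + 1, ∃ S : Finset V, S.card = j ∧ G.IsClique S := by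
    intro j
    induction j with
    | zero => exact fun _ => ⟨∅, by simp⟩
    | succ j ih =>
      intro hj
      obtain ⟨S, hS, hcl⟩ := ih (by omega)
      -- The hypothesis concerns sets of size exactly `k`, so the clique is padded with arbitrary
      -- vertices before it is extended.
      obtain ⟨S', hSS', hS'⟩ := Finset.exists_superset_card_eq (s := S) (n := k) (by omega) hk
      obtain ⟨v, hv, hadj⟩ := h S' hS'
      refine ⟨insert v S, ?_, ?_⟩
      · rw [Finset.card_insert_of_notMem fun hvS => hv (hSS' hvS), hS]
      · rw [Finset.coe_insert]
        exact hcl.insert fun b hb _ => (hadj b (hSS' hb)).symm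
  obtain ⟨S, hS, hcl⟩ := key (k + 1) le_rfl
  have := hcl.card_le_cliqueNum
  omega

/-! ### Random marks: insertion cliques and common neighbours. -/

theorem pi_bernoulli_forall_true {ι : Type*} [Fintype ι] (q : I) (E : Finset ι) :
    (Measure.pi fun _ : ι => bernoulliMeasure true false q) {x | ∀ e ∈ E, x e = true} =
      ENNReal.ofReal q ^ E.card := by
  classical
  have : {x : ι → Bool | ∀ e ∈ E, x e = true} =
      Set.univ.pi fun e => if e ∈ E then {true} else Set.univ := by
    ext b
    simp only [Set.mem_ofPred_eq, Set.mem_univ_pi]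
    refine forall_congr' fun j => ?_
    by_cases hj : j ∈ E <;> simp [hj]
  have h1 : bernoulliMeasure true false q {true} = ENNReal.ofReal q := by
    rw [bernoulliMeasure_apply_of_mem_of_notMem _ (by measurability) (by simp) (by simp)]
    rw [ENNReal.ofReal, ENNReal.coe_inj]
    ext
    simp [q.2.1]
  rw [this, Measure.pi_pi]
  calc ∏ j, bernoulliMeasure true false q (if j ∈ E then {true} else Set.univ)
      = ∏ j, (if j ∈ E then ENNReal.ofReal q else 1) := by
        refine Finset.prod_congr rfl fun j _ => ?_
        split_ifs
        · exact h1
        · simp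
    _ = _ := by simp [Finset.prod_ite_mem]

/-- The expected number of `m`-cliques formed by the insertion marks bounds the probability that
there is one. -/
theorem pi_bernoulli_exists_clique_le (n m : ℕ) (q : I) :
    (Measure.pi fun _ : Sym2 (Fin n) => bernoulliMeasure true false q)
      {x | ∃ J : Finset (Fin n), J.card = m ∧ ∀ u ∈ J, ∀ v ∈ J, u ≠ v → x s(u, v) = true} ≤
      n ^ m * ENNReal.ofReal q ^ m.choose 2 := by
  classical
  have hsub : {x : Sym2 (Fin n) → Bool | ∃ J : Finset (Fin n), J.card = m ∧
      ∀ u ∈ J, ∀ v ∈ J, u ≠ v → x s(u, v) = true} ⊆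
      ⋃ J ∈ (Finset.univ : Finset (Fin n)).powersetCard m,
        {x | ∀ e ∈ J.offDiag.image Sym2.mk.uncurry, x e = true} := by
    rintro x ⟨J, hJ, h⟩
    simp only [Set.mem_iUnion]
    refine ⟨J, by simpa using hJ, ?_⟩
    simp only [Set.mem_ofPred_eq, Finset.mem_image, Finset.mem_offDiag]
    rintro _ ⟨⟨u, v⟩, ⟨hu, hv, huv⟩, rfl⟩
    exact h u hu v hv huv
  calc _ ≤ ∑ J ∈ (Finset.univ : Finset (Fin n)).powersetCard m, ENNReal.ofReal q ^ m.choose 2 := by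
        refine (measure_mono hsub).trans ((measure_biUnion_finset_le _ _).trans ?_)
        refine Finset.sum_le_sum fun J hJ => ?_
        rw [pi_bernoulli_forall_true, Sym2.card_image_offDiag, (Finset.mem_powersetCard.1 hJ).2]
    _ = n.choose m * ENNReal.ofReal q ^ m.choose 2 := by simp
    _ ≤ _ := by
        gcongr
        exact_mod_cast Nat.choose_le_pow n m

/-- For independent `Y e` and disjoint `F v`, the probability that each `F v` contains a
failure. -/
theorem iIndepFun_forall_exists_false {Ω ι V : Type*} [MeasurableSpace Ω] {μ : Measure Ω}
    [IsProbabilityMeasure μ] {Y : ι → Ω → Bool} (hY : iIndepFun Y μ) (hm : ∀ e, Measurable (Y e))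
    {a : ℝ} (ha0 : 0 ≤ a) (F : V → Finset ι)
    (W : Finset V) (hF : (W : Set V).PairwiseDisjoint F) {k : ℕ} (hk : ∀ v ∈ W, (F v).card = k)
    (ha : ∀ v ∈ W, ∀ e ∈ F v, ENNReal.ofReal a ≤ μ {ω | Y e ω = true}) :
    μ {ω | ∀ v ∈ W, ∃ e ∈ F v, Y e ω = false} ≤ ENNReal.ofReal (1 - a ^ k) ^ W.card := by
  classical
  have hone : ∀ v ∈ W, μ {ω | ∃ e ∈ F v, Y e ω = false} ≤ ENNReal.ofReal (1 - a ^ k) := by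
    intro v hv
    have hcompl : {ω | ∃ e ∈ F v, Y e ω = false} = (⋂ e ∈ F v, Y e ⁻¹' {true})ᶜ := by
      ext ω; simp
    rw [hcompl, prob_compl_eq_one_sub
      (Finset.measurableSet_biInter _ fun e _ => hm e (by measurability)),
      hY.measure_inter_preimage_eq_mul _ fun _ _ => by measurability,
      ENNReal.ofReal_sub _ (by positivity), ENNReal.ofReal_one, ENNReal.ofReal_pow ha0]
    gcongr
    rw [← hk v hv]
    exact Finset.pow_card_le_prod _ _ _ fun e he => ha v hv e he
  induction W using Finset.induction_on with
  | empty => simp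
  | insert v W hv ih =>
    have hdisj : Disjoint (F v) (W.biUnion F) := by
      rw [Finset.disjoint_biUnion_right]
      exact fun w hw => hF (by simp) (by simp [hw]) (fun h => hv (h ▸ hw))
    -- The event for `v` and the joint event for `W` read disjoint families of the `Y e`, so their
    -- probabilities multiply.
    have hind := hY.indepFun_finset _ _ hdisj hm
    have hfin : ∀ (T : Finset ι) (s : Set (T → Bool)), MeasurableSet s :=
      fun T s => s.toFinite.measurableSet
    have hmul := hind.measure_inter_preimage_eq_mul
      {y | ∃ e : F v, y e = false} {y | ∀ w (hw : w ∈ W), ∃ e, ∃ he : e ∈ F w,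
        y ⟨e, Finset.mem_biUnion.2 ⟨w, hw, he⟩⟩ = false} (hfin _ _) (hfin _ _)
    have h1 : (fun ω (e : F v) => Y e ω) ⁻¹' {y | ∃ e : F v, y e = false} =
        {ω | ∃ e ∈ F v, Y e ω = false} := by
      ext ω; simp
    have h2 : (fun ω (e : W.biUnion F) => Y e ω) ⁻¹' {y | ∀ w (hw : w ∈ W), ∃ e, ∃ he : e ∈ F w,
        y ⟨e, Finset.mem_biUnion.2 ⟨w, hw, he⟩⟩ = false} =
        {ω | ∀ w ∈ W, ∃ e ∈ F w, Y e ω = false} := by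
      ext ω; simp
    rw [h1, h2] at hmul
    have h3 : {ω | ∀ w ∈ insert v W, ∃ e ∈ F w, Y e ω = false} =
        {ω | ∃ e ∈ F v, Y e ω = false} ∩ {ω | ∀ w ∈ W, ∃ e ∈ F w, Y e ω = false} := by
      ext ω; simp
    rw [h3, hmul, Finset.card_insert_of_notMem hv, pow_succ']
    gcongr
    · exact hone v (by simp)
    · exact ih (hF.subset (by simp)) (fun w hw => hk w (by simp [hw]))
        (fun w hw => ha w (by simp [hw])) (fun w hw => hone w (by simp [hw]))

/-- The joint law of the deletion and insertion marks. -/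
noncomputable def marksMeasure (p q : I) (n : ℕ) :
    Measure ((Sym2 (Fin n) → Bool) × (Sym2 (Fin n) → Bool)) :=
  (Measure.pi fun _ : Sym2 (Fin n) => bernoulliMeasure true false p).prod
    (Measure.pi fun _ : Sym2 (Fin n) => bernoulliMeasure true false q)

instance (p q : I) (n : ℕ) : IsProbabilityMeasure (marksMeasure p q n) := by
  unfold marksMeasure; infer_instance

/-- The probability that `S` has no common neighbour in the perturbed graph. -/
theorem marksMeasure_no_extension_le {n : ℕ} (G : SimpleGraph (Fin n)) {p q : I}
    (hpq : (q : ℝ) ≤ 1 - p) (S : Finset (Fin n)) :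
    marksMeasure p q n {m | ¬ ∃ v ∉ S, ∀ u ∈ S, (perturb G m.1 m.2).Adj u v} ≤
      ENNReal.ofReal (1 - (q : ℝ) ^ S.card) ^ (n - S.card) := by
  classical
  -- `f e` reads off whether `e` is present in the perturbed graph. It uses only the two marks of
  -- `e`, so presence is independent over pairs.
  let f : Sym2 (Fin n) → Bool × Bool → Bool := fun e b => if e ∈ G.edgeSet then !b.1 else b.2
  set ρ := (bernoulliMeasure true false p).prod (bernoulliMeasure true false q) with hρ
  have hmf : ∀ e, Measurable (f e) := fun e => measurable_of_finite _
  have hY : iIndepFun (fun e (ω : Sym2 (Fin n) → Bool × Bool) => f e (ω e))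
      (Measure.pi fun _ => ρ) := iIndepFun_pi fun e => (hmf e).aemeasurable
  have hmp := measurePreserving_arrowProdEquivProdArrow Bool Bool (Sym2 (Fin n))
    (fun _ => bernoulliMeasure true false p) (fun _ => bernoulliMeasure true false q)
  have hq : ∀ e, ENNReal.ofReal q ≤ ρ {b | f e b = true} := by
    intro e
    by_cases he : e ∈ G.edgeSet
    · have : {b : Bool × Bool | f e b = true} = {false} ×ˢ Set.univ := by
        ext ⟨b, c⟩; simp [f, he]
      rw [this, hρ, Measure.prod_prod, measure_univ, mul_one,
        bernoulliMeasure_apply_of_notMem_of_mem _ (by measurability) (by simp) (by simp),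
        ENNReal.ofReal, ENNReal.coe_le_coe, Real.toNNReal_le_iff_le_coe]
      simpa using hpq
    · have : {b : Bool × Bool | f e b = true} = Set.univ ×ˢ {true} := by
        ext ⟨b, c⟩; simp [f, he]
      rw [this, hρ, Measure.prod_prod, measure_univ, one_mul,
        bernoulliMeasure_apply_of_mem_of_notMem _ (by measurability) (by simp) (by simp),
        ENNReal.ofReal, ENNReal.coe_le_coe, Real.toNNReal_le_iff_le_coe]
      simp
  -- Each `v` outside `S` gets the star of pairs joining it to `S`; these stars are pairwise
  -- disjoint.
  have hmain := iIndepFun_forall_exists_false hY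
    (fun e => (hmf e).comp (measurable_pi_apply e)) q.2.1
    (fun v => S.image fun u => s(u, v)) Sᶜ (k := S.card) ?_ ?_ ?_
  · rw [Finset.card_compl, Fintype.card_fin] at hmain
    refine le_trans ?_ hmain
    rw [marksMeasure, ← hmp.measure_preimage_equiv]
    refine measure_mono fun ω hω v hv => ?_
    simp only [Set.mem_preimage, Set.mem_ofPred_eq] at hω
    push Not at hω
    obtain ⟨u, hu, hadj⟩ := hω v (Finset.mem_compl.1 hv)
    refine ⟨s(u, v), Finset.mem_image_of_mem _ hu, ?_⟩
    have huv : u ≠ v := by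
      rintro rfl
      exact Finset.mem_compl.1 hv hu
    by_contra hf
    refine hadj ⟨huv, ?_⟩
    have h1 : ((MeasurableEquiv.arrowProdEquivProdArrow Bool Bool (Sym2 (Fin n))) ω).1 s(u, v) =
      (ω s(u, v)).1 := rfl
    have h2 : ((MeasurableEquiv.arrowProdEquivProdArrow Bool Bool (Sym2 (Fin n))) ω).2 s(u, v) =
      (ω s(u, v)).2 := rfl
    rw [h1, h2]
    by_cases hG : G.Adj u v <;> simpa [f, hG] using hf
  · intro v hv w hw hvw
    rw [Function.onFun, Finset.disjoint_left]
    intro e he he'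
    obtain ⟨u, hu, rfl⟩ := Finset.mem_image.1 he
    obtain ⟨u', hu', heq⟩ := Finset.mem_image.1 he'
    rcases Sym2.eq_iff.1 heq with ⟨-, h⟩ | ⟨h, -⟩
    · exact hvw h.symm
    · have : v ∉ S := by simpa using hv
      exact this (h ▸ hu')
  · intro v hv
    refine Finset.card_image_of_injective _ fun u u' h => ?_
    rcases Sym2.eq_iff.1 h with ⟨h, -⟩ | ⟨h, h'⟩
    · exact h
    · exact h.trans h'
  · intro v _ e _
    have := (measurePreserving_eval (fun _ : Sym2 (Fin n) => ρ) e).measure_preimage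
      (s := {b | f e b = true}) (Set.toFinite _).measurableSet.nullMeasurableSet
    refine (hq e).trans (le_of_eq ?_)
    rw [← this]
    rfl

/-! ### Failure probabilities for the noisy graph. -/

instance {d : ℕ} (ν : Measure (Fin d → ℝ)) [IsProbabilityMeasure ν] (p q : I) (n : ℕ) :
    IsProbabilityMeasure (sampleMeasure ν p q n) := by
  unfold sampleMeasure; infer_instance

theorem measurableSet_noisyGraph_adj {d n : ℕ} (N : Seminorm ℝ (Fin d → ℝ)) (r : ℝ)
    (u v : Fin n) : MeasurableSet {s : Sample d n | (noisyGraph N r n s).Adj u v} := by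
  have hG : MeasurableSet {s : Sample d n | (geometricGraph N r s.1).Adj u v} := by
    have hle : MeasurableSet {s : Sample d n | N (s.1 u - s.1 v) ≤ r} :=
      measurableSet_le ((continuous_seminorm N).measurable.comp
        (((measurable_pi_apply u).comp measurable_fst).sub
          ((measurable_pi_apply v).comp measurable_fst))) measurable_const
    exact (MeasurableSet.const (u ≠ v)).inter hle
  have hdel : MeasurableSet {s : Sample d n | s.2.1 s(u, v) = false} :=
    measurableSet_eq_fun ((measurable_pi_apply s(u, v)).comp
      (measurable_fst.comp measurable_snd)) measurable_const
  have hins : MeasurableSet {s : Sample d n | s.2.2 s(u, v) = true} :=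
    measurableSet_eq_fun ((measurable_pi_apply s(u, v)).comp
      (measurable_snd.comp measurable_snd)) measurable_const
  exact (MeasurableSet.const (u ≠ v)).inter ((hG.inter hdel).union (hG.compl.inter hins))

/-- First moment bound for the failure of the `k`-extension property. -/
theorem sampleMeasure_no_extension_le {d n : ℕ} {ν : Measure (Fin d → ℝ)} [IsProbabilityMeasure ν]
    (N : Seminorm ℝ (Fin d → ℝ)) (r : ℝ) {p q : I} (hpq : (q : ℝ) ≤ 1 - p) (k : ℕ) :
    sampleMeasure ν p q n {s | ¬ ∀ S : Finset (Fin n), S.card = k →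
      ∃ v ∉ S, ∀ u ∈ S, (noisyGraph N r n s).Adj u v} ≤
      n ^ k * ENNReal.ofReal (1 - (q : ℝ) ^ k) ^ (n - k) := by
  classical
  have hsub : {s : Sample d n | ¬ ∀ S : Finset (Fin n), S.card = k →
      ∃ v ∉ S, ∀ u ∈ S, (noisyGraph N r n s).Adj u v} ⊆
      ⋃ S ∈ (Finset.univ : Finset (Fin n)).powersetCard k,
        {s | ¬ ∃ v ∉ S, ∀ u ∈ S, (noisyGraph N r n s).Adj u v} := by
    intro s hs
    simp only [Set.mem_ofPred_eq, not_forall] at hs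
    obtain ⟨S, hS, h⟩ := hs
    simp only [Set.mem_iUnion]
    exact ⟨S, by simpa using hS, h⟩
  calc _ ≤ ∑ S ∈ (Finset.univ : Finset (Fin n)).powersetCard k,
          ENNReal.ofReal (1 - (q : ℝ) ^ k) ^ (n - k) := by
        refine (measure_mono hsub).trans ((measure_biUnion_finset_le _ _).trans ?_)
        refine Finset.sum_le_sum fun S hS => ?_
        obtain rfl : S.card = k := (Finset.mem_powersetCard.1 hS).2
        -- The bound on the marks holds for every geometric graph, hence for every fixed position of
        -- the points.
        refine prod_le_of_section_le _ (marksMeasure p q n) ?_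
          fun x => marksMeasure_no_extension_le (geometricGraph N r x) hpq S
        have : {s : Sample d n | ¬ ∃ v ∉ S, ∀ u ∈ S, (noisyGraph N r n s).Adj u v} =
            (⋃ v ∈ Sᶜ, ⋂ u ∈ S, {s : Sample d n | (noisyGraph N r n s).Adj u v})ᶜ := by
          ext s; simp
        rw [this]
        exact (Finset.measurableSet_biUnion _ fun v _ => Finset.measurableSet_biInter _ fun u _ =>
          measurableSet_noisyGraph_adj N r u v).compl
    _ = n.choose k * ENNReal.ofReal (1 - (q : ℝ) ^ k) ^ (n - k) := by simp
    _ ≤ _ := by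
        gcongr
        exact_mod_cast Nat.choose_le_pow n k

/-- A large clique forces a vertex of degree at least `M`, an event of the points, or an insertion
clique on `m + 1` vertices, an event of the marks. -/
theorem sampleMeasure_cliqueNum_gt_le {d n : ℕ} {ν : Measure (Fin d → ℝ)} [IsProbabilityMeasure ν]
    (N : Seminorm ℝ (Fin d → ℝ)) {r : ℝ} {c : ℝ≥0∞} (hc : ∀ y, ν {z | N (y - z) ≤ r} ≤ c)
    (p q : I) (M m : ℕ) :
    sampleMeasure ν p q n {s | ¬ (noisyGraph N r n s).cliqueNum ≤ M * m} ≤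
      n * (n * c) ^ M + n ^ (m + 1) * ENNReal.ofReal q ^ (m + 1).choose 2 := by
  set D : Set (Fin n → Fin d → ℝ) := {x | ∃ i, ∃ T : Finset (Fin n), T.card = M ∧
    ∀ j ∈ T, (geometricGraph N r x).Adj i j}
  set E : Set (Sym2 (Fin n) → Bool) := {x | ∃ J : Finset (Fin n), J.card = m + 1 ∧
    ∀ u ∈ J, ∀ v ∈ J, u ≠ v → x s(u, v) = true}
  have hsub : {s : Sample d n | ¬ (noisyGraph N r n s).cliqueNum ≤ M * m} ⊆
      D ×ˢ Set.univ ∪ Set.univ ×ˢ (Set.univ ×ˢ E) := by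
    intro s hs
    by_contra hcon
    simp only [Set.mem_union, Set.mem_prod, Set.mem_univ, and_true, true_and, not_or] at hcon
    exact hs (cliqueNum_perturb_le _ _ _ (fun i T hT h => hcon.1 ⟨i, T, hT, h⟩)
      fun J hJ h => hcon.2 ⟨J, hJ, h⟩)
  refine (measure_mono hsub).trans ((measure_union_le _ _).trans ?_)
  rw [sampleMeasure, Measure.prod_prod, Measure.prod_prod, Measure.prod_prod]
  simp only [measure_univ, mul_one, one_mul]
  exact add_le_add (pi_exists_degree_le N hc) (pi_bernoulli_exists_clique_le n (m + 1) q)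

/-! ### Asymptotic estimates. -/

/-- Subadditivity replaces the complement formula, so no measurability of `P` is needed. -/
theorem tendsto_measure_one_of_not_le {Ω : ℕ → Type*} [∀ n, MeasurableSpace (Ω n)]
    (μ : ∀ n, Measure (Ω n)) [∀ n, IsProbabilityMeasure (μ n)] {P : ∀ n, Ω n → Prop}
    {b : ℕ → ℝ≥0∞} (hb : Tendsto b atTop (𝓝 0)) (h : ∀ᶠ n in atTop, μ n {ω | ¬ P n ω} ≤ b n) :
    Tendsto (fun n => μ n {ω | P n ω}) atTop (𝓝 1) := by
  have hlow : Tendsto (fun n => 1 - b n) atTop (𝓝 1) := by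
    simpa using ENNReal.Tendsto.sub tendsto_const_nhds hb (Or.inl ENNReal.one_ne_top)
  refine tendsto_of_tendsto_of_tendsto_of_le_of_le' hlow tendsto_const_nhds ?_
    (Eventually.of_forall fun n => prob_le_one)
  filter_upwards [h] with n hn
  rw [tsub_le_iff_right]
  calc 1 = μ n ({ω | P n ω} ∪ {ω | ¬ P n ω}) := by
        rw [← measure_univ (μ := μ n)]
        congr 1
        ext ω
        simp [em]
    _ ≤ μ n {ω | P n ω} + μ n {ω | ¬ P n ω} := measure_union_le _ _
    _ ≤ _ := by gcongr

theorem tendsto_degree_bound {K α : ℝ} (hK : 0 < K) {M d : ℕ} (hM : 1 < α * M) {r : ℕ → ℝ}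
    (hr : ∀ n, 0 < r n) (hnr : ∀ᶠ n : ℕ in atTop, (n : ℝ) * r n ^ d ≤ (n : ℝ) ^ (-α)) :
    Tendsto (fun n : ℕ => (n : ℝ≥0∞) * (n * ENNReal.ofReal (K * r n ^ d)) ^ M) atTop (𝓝 0) := by
  have hlim : Tendsto (fun n : ℕ => ENNReal.ofReal (K ^ M * (n : ℝ) ^ (-(α * M - 1)))) atTop
      (𝓝 0) := by
    have h1 := (tendsto_rpow_neg_atTop (sub_pos.2 hM)).comp tendsto_natCast_atTop_atTop
    simpa using ENNReal.tendsto_ofReal (h1.const_mul (K ^ M))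
  refine tendsto_of_tendsto_of_tendsto_of_le_of_le' tendsto_const_nhds hlim
    (Eventually.of_forall fun n => zero_le) ?_
  filter_upwards [hnr, eventually_ge_atTop 1] with n hn hn1
  have hn0 : (0 : ℝ) < n := by exact_mod_cast hn1
  have hrn := hr n
  rw [← ENNReal.ofReal_natCast n, ← ENNReal.ofReal_mul hn0.le, ← ENNReal.ofReal_pow (by positivity),
    ← ENNReal.ofReal_mul hn0.le]
  refine ENNReal.ofReal_le_ofReal ?_
  calc (n : ℝ) * (n * (K * r n ^ d)) ^ M = n * (K * (n * r n ^ d)) ^ M := by ring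
    _ ≤ n * (K * (n : ℝ) ^ (-α)) ^ M := by gcongr
    _ = K ^ M * (n : ℝ) ^ (-(α * M - 1)) := by
        rw [mul_pow, ← Real.rpow_natCast (_ ^ (-α)), ← Real.rpow_mul hn0.le, neg_sub,
          sub_eq_add_neg, Real.rpow_add hn0, Real.rpow_one, neg_mul]
        ring

theorem tendsto_ofReal_one_div_natCast :
    Tendsto (fun n : ℕ => ENNReal.ofReal (1 / (n : ℝ))) atTop (𝓝 0) := by
  simpa using ENNReal.tendsto_ofReal (tendsto_one_div_atTop_nhds_zero_nat (𝕜 := ℝ))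

/-- Squaring clears the 1/2 in the binomial exponent; then 2m + 4 ≤ 4(m + 1) exhibits a power of `x
^ 4 * q ^ m`. -/
theorem pow_mul_pow_choose_le {x q : ℝ} (hx : 1 ≤ x) (hq : 0 ≤ q) {m : ℕ}
    (h : x ^ 4 * q ^ m ≤ 1) : x ^ (m + 1) * q ^ (m + 1).choose 2 ≤ 1 / x := by
  have hx0 : 0 < x := one_pos.trans_le hx
  rw [le_div_iff₀ hx0]
  refine le_of_pow_le_pow_left₀ two_ne_zero zero_le_one ?_
  have hch : (m + 1).choose 2 * 2 = m * (m + 1) := by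
    rw [Nat.choose_two_right, Nat.div_mul_cancel (Nat.even_mul_pred_self _).two_dvd]
    simp [mul_comm]
  calc (x ^ (m + 1) * q ^ (m + 1).choose 2 * x) ^ 2
      = x ^ (2 * m + 4) * q ^ ((m + 1).choose 2 * 2) := by rw [pow_mul]; ring
    _ ≤ x ^ (4 * (m + 1)) * q ^ (m * (m + 1)) := by
        rw [hch]
        gcongr
        omega
    _ = (x ^ 4 * q ^ m) ^ (m + 1) := by rw [mul_pow, ← pow_mul, ← pow_mul]
    _ ≤ 1 ^ 2 := by
        rw [one_pow]
        exact pow_le_one₀ (by positivity) h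

theorem tendsto_ofReal_exp_neg_sqrt :
    Tendsto (fun n : ℕ => ENNReal.ofReal (Real.exp (-(Real.sqrt n / 4)))) atTop (𝓝 0) := by
  have h : Tendsto (fun n : ℕ => Real.exp (-(Real.sqrt n / 4))) atTop (𝓝 0) :=
    Real.tendsto_exp_neg_atTop_nhds_zero.comp
      ((Real.tendsto_sqrt_atTop.comp tendsto_natCast_atTop_atTop).atTop_div_const (by norm_num))
  simpa using ENNReal.tendsto_ofReal h

theorem eventually_log_bounds : ∀ᶠ n : ℕ in atTop,
    Real.log n ^ 2 ≤ Real.sqrt n / 4 ∧ Real.log n ≤ n / 2 := by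
  have h1 := (isLittleO_log_rpow_rpow_atTop (s := 1 / 2) 2 (by norm_num)).bound
    (show (0 : ℝ) < 1 / 4 by norm_num)
  have h2 := Real.isLittleO_log_id_atTop.bound (show (0 : ℝ) < 1 / 2 by norm_num)
  filter_upwards [tendsto_natCast_atTop_atTop.eventually h1,
    tendsto_natCast_atTop_atTop.eventually h2] with n h1 h2
  constructor
  · rw [Real.sqrt_eq_rpow]
    have := (le_abs_self _).trans h1
    rw [Real.norm_of_nonneg (by positivity), Real.rpow_two] at this
    linarith
  · have := (le_abs_self _).trans h2
    rw [id, Real.norm_of_nonneg (by positivity)] at this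
    linarith

/-- Here q^k ≥ n^(-1/2) and n - k ≥ n/2, so the second factor is at most exp(-√n/2), while n^k ≤
exp(log² n) ≤ exp(√n/4). -/
theorem pow_mul_one_sub_pow_le {n k : ℕ} {q : ℝ} (hn : 1 ≤ n) (hq0 : 0 < q) (hq1 : q ≤ 1)
    (hlog : Real.log n ^ 2 ≤ Real.sqrt n / 4) (hlog' : Real.log n ≤ n / 2)
    (hk : (k : ℝ) ≤ Real.log n) (hqk : (k : ℝ) * Real.log (1 / q) ≤ Real.log n / 2) :
    (n : ℝ) ^ k * (1 - q ^ k) ^ (n - k) ≤ Real.exp (-(Real.sqrt n / 4)) := by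
  have hn0 : (0 : ℝ) < n := by exact_mod_cast hn
  have hkn : (k : ℝ) ≤ n / 2 := hk.trans hlog'
  have hkn' : k ≤ n := by
    have : (k : ℝ) ≤ n := by linarith
    exact_mod_cast this
  have hs : Real.sqrt n * Real.sqrt n = n := Real.mul_self_sqrt hn0.le
  have hspos : 0 < Real.sqrt n := Real.sqrt_pos.2 hn0
  have hqk' : 1 / Real.sqrt n ≤ q ^ k := by
    rw [one_div, ← Real.exp_log hspos, ← Real.exp_neg, Real.log_sqrt hn0.le,
      ← Real.exp_log hq0, ← Real.exp_nat_mul]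
    refine Real.exp_le_exp.2 ?_
    rw [one_div, Real.log_inv] at hqk
    linarith
  have hq2 : q ^ k ≤ 1 := pow_le_one₀ hq0.le hq1
  calc (n : ℝ) ^ k * (1 - q ^ k) ^ (n - k)
      ≤ Real.exp (Real.log n) ^ k * Real.exp (-q ^ k) ^ (n - k) := by
        rw [Real.exp_log hn0]
        have : 0 ≤ 1 - q ^ k := by linarith
        gcongr
        exact Real.one_sub_le_exp_neg _
    _ = Real.exp (k * Real.log n - (n - k) * q ^ k) := by
        rw [← Real.exp_nat_mul, ← Real.exp_nat_mul, ← Real.exp_add, Nat.cast_sub hkn']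
        ring_nf
    _ ≤ _ := by
        refine Real.exp_le_exp.2 ?_
        have h1 : k * Real.log n ≤ Real.log n ^ 2 := by
          rw [sq]
          exact mul_le_mul_of_nonneg_right hk (Real.log_natCast_nonneg n)
        have h2 : Real.sqrt n / 2 ≤ (n - k) * q ^ k := by
          calc Real.sqrt n / 2 = (n / 2) * (1 / Real.sqrt n) := by
                nth_rw 2 [← hs]
                field_simp
            _ ≤ (n - k) * q ^ k :=
                mul_le_mul (by linarith) hqk' (by positivity) (by linarith)
        linarith

end NoisyRGG

open NoisyRGG

/-! ### The two regimes of q. -/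

theorem corollary1 (d : ℕ) (N : Seminorm ℝ (Fin d → ℝ)) (hN : ∀ x, N x = 0 → x = 0)
    (p : unitInterval) (hp0 : 0 < (p : ℝ)) (hp1 : (p : ℝ) < 1)
    (α : ℝ) (hα0 : 0 < α) (hα1 : α ≤ 1 / (NoisyRGG.besicovitchConst N : ℝ) ^ 2) :
    ∃ C₁ C₂ : ℝ, 0 < C₁ ∧ 0 < C₂ ∧ C₂ < 1 ∧
      ∀ (ν : Measure (Fin d → ℝ)) [IsProbabilityMeasure ν], NoisyRGG.HasBoundedDensity ν →
      ∀ r : ℕ → ℝ, (∀ n, 0 < r n) → Tendsto r atTop (𝓝 0) →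
      (∀ᶠ n : ℕ in atTop, (n : ℝ) * r n ^ d ≤ (n : ℝ) ^ (-α)) →
      ∀ q : ℕ → unitInterval,
        ((∀ᶠ n : ℕ in atTop, (q n : ℝ) ≤ (1 / (n : ℝ)) ^ C₁) →
          NoisyRGG.SameOrderWHP (fun n => NoisyRGG.sampleMeasure ν p (q n) n)
            (fun n s => ((NoisyRGG.noisyGraph N (r n) n s).cliqueNum : ℝ))
            (fun _ => 1)) ∧
        ((∀ᶠ n : ℕ in atTop, (1 / (n : ℝ)) ^ C₁ < (q n : ℝ) ∧ (q n : ℝ) ≤ C₂) →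
          NoisyRGG.SameOrderWHP (fun n => NoisyRGG.sampleMeasure ν p (q n) n)
            (fun n s => ((NoisyRGG.noisyGraph N (r n) n s).cliqueNum : ℝ))
            (fun n => Real.logb (1 / (q n : ℝ)) (n : ℝ))) := by
  obtain ⟨M, hM⟩ := exists_nat_gt (1 / α)
  have hMα : 1 < α * M := by rwa [div_lt_iff₀' hα0] at hM
  have hM0 : (0 : ℝ) < M := (one_div_pos.2 hα0).trans hM
  -- The exponent 3 gives n² q ≤ 1/n in a) and log_{1/q} n ≥ 1/3 in b). The bound 1 - p makes every
  -- pair present with probability at least q; 1/2 keeps log (1/q) away from 0.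
  refine ⟨3, min (1 - p) (1 / 2), by norm_num, lt_min (by linarith) (by norm_num),
    (min_le_right _ _).trans_lt (by norm_num), ?_⟩
  intro ν _ hν r hr _ hnr q
  obtain ⟨K, hK, hball⟩ := hν.exists_ball_le N hN
  have hdeg := tendsto_degree_bound hK hMα hr hnr
  have hbad : Tendsto (fun n : ℕ => (n : ℝ≥0∞) * (n * ENNReal.ofReal (K * r n ^ d)) ^ M +
      ENNReal.ofReal (1 / n)) atTop (𝓝 0) := by
    simpa using hdeg.add tendsto_ofReal_one_div_natCast
  constructor
  · intro hq
    refine ⟨⟨M, hM0, tendsto_measure_one_of_not_le _ hbad ?_⟩, ⟨1, one_pos, ?_⟩⟩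
    · filter_upwards [hq, eventually_ge_atTop 1] with n hqn hn1
      have hn0 : (0 : ℝ) < n := by exact_mod_cast hn1
      -- With `m = 1` the second bad event is that some pair of distinct vertices has an insertion
      -- mark.
      have h := sampleMeasure_cliqueNum_gt_le N (fun y => hball y (r n) (hr n)) p (q n) M 1 (n := n)
      refine le_trans (measure_mono fun s hs => ?_) (h.trans ?_)
      · intro hle
        exact hs (by rw [mul_one]; exact_mod_cast (mul_one M ▸ hle))
      · gcongr
        rw [← ENNReal.ofReal_natCast n, ← ENNReal.ofReal_pow hn0.le, Nat.choose_self, pow_one,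
          ← ENNReal.ofReal_mul (by positivity)]
        refine ENNReal.ofReal_le_ofReal ?_
        calc (n : ℝ) ^ 2 * (q n : ℝ) ≤ (n : ℝ) ^ 2 * (1 / (n : ℝ)) ^ (3 : ℝ) := by gcongr
          _ = 1 / (n : ℝ) := by
            rw [show (3 : ℝ) = (3 : ℕ) by norm_num, Real.rpow_natCast]
            field_simp
    · refine tendsto_const_nhds.congr' ?_
      filter_upwards [eventually_ge_atTop 1] with n hn1
      have : {s : Sample d n | 1 * 1 ≤ ((noisyGraph N (r n) n s).cliqueNum : ℝ)} = Set.univ := by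
        refine Set.eq_univ_of_forall fun s => ?_
        have := lt_cliqueNum_of_extension (noisyGraph N (r n) n s) (k := 0) (by simp)
          fun S hS => ⟨⟨0, hn1⟩, by simp [Finset.card_eq_zero.1 hS]⟩
        simpa [Nat.one_le_cast, Nat.one_le_iff_ne_zero, Nat.pos_iff_ne_zero] using this
      rw [this, measure_univ]
  · intro hq
    have hq' : ∀ᶠ n : ℕ in atTop, 1 < n ∧ 0 < (q n : ℝ) ∧ (q n : ℝ) ≤ 1 - p ∧
        1 / 2 ≤ Real.log (1 / (q n : ℝ)) ∧ Real.log (1 / (q n : ℝ)) ≤ 3 * Real.log n := by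
      filter_upwards [hq, eventually_gt_atTop 1] with n hqn hn1
      have hn0 : (0 : ℝ) < n := by exact_mod_cast one_pos.trans hn1
      have hq0 : 0 < (q n : ℝ) := lt_of_le_of_lt (by positivity) hqn.1
      refine ⟨hn1, hq0, hqn.2.trans (min_le_left _ _), ?_, ?_⟩
      · have h2 : (2 : ℝ) ≤ 1 / q n := by
          rw [le_div_iff₀ hq0]
          linarith [hqn.2.trans (min_le_right _ _)]
        linarith [Real.log_le_log two_pos h2, Real.log_two_gt_d9]
      · have h := Real.log_le_log (by positivity) hqn.1.le
        rw [Real.log_rpow (by positivity), one_div, Real.log_inv] at h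
        rw [one_div, Real.log_inv]
        linarith
    constructor
    -- With m = ⌈4L⌉ one has q^m ≤ n^(-4), as the first moment requires, and m < 4L + 1 ≤ 7L because
    -- 3L ≥ 1.
    · refine ⟨7 * M, by positivity, tendsto_measure_one_of_not_le _ hbad ?_⟩
      filter_upwards [hq'] with n ⟨hn1, hq0, _, hℓ, hℓn⟩
      have hn0 : (0 : ℝ) < n := by exact_mod_cast one_pos.trans hn1
      set ℓ := Real.log (1 / (q n : ℝ)) with hℓdef
      have hℓ0 : 0 < ℓ := by linarith
      set L := Real.logb (1 / (q n : ℝ)) n with hL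
      have hLℓ : L * ℓ = Real.log n := div_mul_cancel₀ _ hℓ0.ne'
      have hL3 : 1 ≤ 3 * L := by
        by_contra! hlt
        nlinarith
      have hceil := Nat.le_ceil (4 * L)
      have hceil' := Nat.ceil_lt_add_one (show 0 ≤ 4 * L by linarith)
      set m := ⌈4 * L⌉₊
      have h := sampleMeasure_cliqueNum_gt_le N (fun y => hball y (r n) (hr n)) p (q n) M m (n := n)
      refine le_trans (measure_mono fun s hs => mt (fun hle => ?_) hs) (h.trans ?_)
      · calc ((noisyGraph N (r n) n s).cliqueNum : ℝ) ≤ M * m := by exact_mod_cast hle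
          _ ≤ M * (7 * L) := by gcongr; linarith
          _ = 7 * M * L := by ring
      · gcongr
        rw [← ENNReal.ofReal_natCast n, ← ENNReal.ofReal_pow hn0.le, ← ENNReal.ofReal_pow hq0.le,
          ← ENNReal.ofReal_mul (by positivity)]
        refine ENNReal.ofReal_le_ofReal (pow_mul_pow_choose_le (by exact_mod_cast hn1.le) hq0.le ?_)
        have hqe : (q n : ℝ) = Real.exp (-ℓ) := by
          rw [hℓdef, one_div, Real.log_inv, neg_neg, Real.exp_log hq0]
        rw [← Real.exp_log hn0, hqe, ← Real.exp_nat_mul, ← Real.exp_nat_mul, ← Real.exp_add,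
          Real.exp_le_one_iff, ← hLℓ]
        push_cast
        nlinarith
    · refine ⟨1 / 2, by norm_num,
        tendsto_measure_one_of_not_le _ tendsto_ofReal_exp_neg_sqrt ?_⟩
      filter_upwards [hq', eventually_log_bounds] with n ⟨hn1, hq0, hqp, hℓ, hℓn⟩ ⟨hlog, hlog'⟩
      have hn0 : (0 : ℝ) < n := by exact_mod_cast one_pos.trans hn1
      set ℓ := Real.log (1 / (q n : ℝ)) with hℓdef
      have hℓ0 : 0 < ℓ := by linarith
      set L := Real.logb (1 / (q n : ℝ)) n with hL
      have hLℓ : L * ℓ = Real.log n := div_mul_cancel₀ _ hℓ0.ne'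
      have hL0 : 0 ≤ L := by
        by_contra! hlt
        nlinarith [Real.log_natCast_nonneg n]
      have hfl := Nat.floor_le (show 0 ≤ L / 2 by linarith)
      have hfl' := Nat.lt_floor_add_one (L / 2)
      -- Rounding down keeps q^k ≥ n^(-1/2), and the extra vertex of the extension argument restores
      -- k + 1 > L/2.
      set k := ⌊L / 2⌋₊
      have hkℓ : (k : ℝ) * ℓ ≤ Real.log n / 2 := by nlinarith
      have hk : (k : ℝ) ≤ Real.log n := by nlinarith
      have hkn : k ≤ n := by
        have : (k : ℝ) ≤ n := by linarith
        exact_mod_cast this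
      refine le_trans (measure_mono fun s hs => mt (fun hext => ?_) hs)
        ((sampleMeasure_no_extension_le N (r n) hqp k (n := n) (ν := ν)).trans ?_)
      · have := lt_cliqueNum_of_extension _ (by simpa using hkn) hext
        have : (k : ℝ) + 1 ≤ (noisyGraph N (r n) n s).cliqueNum := by exact_mod_cast this
        linarith
      · have hq1 : (q n : ℝ) ^ k ≤ 1 := pow_le_one₀ hq0.le (q n).2.2
        rw [← ENNReal.ofReal_natCast n, ← ENNReal.ofReal_pow hn0.le,
          ← ENNReal.ofReal_pow (by linarith), ← ENNReal.ofReal_mul (by positivity)]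
        exact ENNReal.ofReal_le_ofReal
          (pow_mul_one_sub_pow_le hn1.le hq0 (q n).2.2 hlog hlog' hk hkℓ)
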